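/- Let $\mathbb F$ be an algebraically closed field of characteristic $p>0$, and let $L$ be a finite-dimensional restricted Lie algebra over $\mathbb F$, that is, a Lie algebra with a $p$-mapping $x\mapsto x^{[p]}$ satisfying $\operatorname{ad}(x^{[p]})=\operatorname{ad}(x)^p$, $(\lambda x)^{[p]}=\lambda^p x^{[p]}$ and $(x+y)^{[p]}=x^{[p]}+y^{[p]}+\sum_{i=1}^{p-1}s_i(x,y)$, where $i\,s_i(x,y)$ is the coefficient of $X^{i-1}$ in $\operatorname{ad}(Xx+y)^{p-1}(x)\in L\otimes\mathbb F[X]$. A restricted subalgebra of $L$ is a Lie subalgebra closed under the $p$-mapping; $\langle S\rangle_p$ denotes the restricted subalgebra generated by a subset $S$ of $L$. A restricted subalgebra $M$ is maximal in a restricted subalgebra $S$ if $M\subsetneq S$ and no restricted subalgebra lies strictly between $M$ and $S$. An element $x$ is $p$-nilpotent of order $n$ if $n$ is the least positive integer with $x^{[p]^n}=0$. The algebra $L$ is almost abelian if $L=\mathbb F x\dotplus A$ as a vector space, where $x\neq 0$, $A$ is an abelian ideal, and $[x,a]=a$ for all $a\in A$. Suppose that $L$ is upper semimodular: whenever $S,T$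 are restricted subalgebras of $L$ such that $S\cap T$ is maximal in $T$, the subalgebra $S$ is maximal in $\langle S,T\rangle_p$. Then $L$ is abelian, or almost abelian, or there are an integer $r\ge 0$, elements $x_1,\dots,x_r\in L$ and an abelian restricted subalgebra $B$ of $L$ such that \[L=\langle x_1,\dots,x_r,B\rangle_p,\] each $x_i$ is $p$-nilpotent of some order $n_i>1$, and $[L,L]\subseteq\langle x_1,\dots,x_r\rangle_p$. -/

import Mathlib

section RestrictedLie

/-- Write `ad(X x + y)^n (x) = ∑ₖ cₙₖ Xᵏ` in the Lie algebra `L[X] = L ⊗ F[X]` of polynomials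
with coefficients in `L`. Then `jacobsonCoeff x y n k` is the coefficient `cₙₖ` in `L`. -/
def jacobsonCoeff {L : Type*} [LieRing L] (x y : L) : ℕ → ℕ → L
  | 0, 0 => x
  | 0, _ + 1 => 0
  | n + 1, 0 => ⁅y, jacobsonCoeff x y n 0⁆
  | n + 1, k + 1 => ⁅x, jacobsonCoeff x y n k⁆ + ⁅y, jacobsonCoeff x y n (k + 1)⁆

/-- The Jacobson polynomials `sᵢ(x, y)`, for `1 ≤ i ≤ p - 1`: the element `i sᵢ(x, y)` is the
coefficient of `Xⁱ⁻¹` in `ad(X x + y)^(p - 1) (x)`. -/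
def jacobsonS (p : ℕ) (F : Type*) {L : Type*} [Field F] [LieRing L] [LieAlgebra F L]
    (i : ℕ) (x y : L) : L :=
  (i : F)⁻¹ • jacobsonCoeff x y (p - 1) (i - 1)

/-- A `p`-mapping `x ↦ x^[p]` on a Lie algebra `L` over a field `F` (of characteristic `p`).
A Lie algebra together with a `p`-mapping is a restricted Lie algebra. -/
structure PMapping (p : ℕ) (F L : Type*) [Field F] [LieRing L] [LieAlgebra F L] where
  /-- the map `x ↦ x^[p]` -/
  toFun : L → L
  ad_toFun : ∀ x : L, LieAlgebra.ad F L (toFun x) = (LieAlgebra.ad F L x) ^ p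
  toFun_smul : ∀ (c : F) (x : L), toFun (c • x) = c ^ p • toFun x
  toFun_add : ∀ x y : L,
    toFun (x + y) = toFun x + toFun y + ∑ i ∈ Finset.Icc 1 (p - 1), jacobsonS p F i x y

namespace PMapping

variable {p : ℕ} {F L : Type*} [Field F] [LieRing L] [LieAlgebra F L]

/-- A restricted subalgebra: a Lie subalgebra closed under the `p`-mapping. -/
def IsRestricted (P : PMapping p F L) (S : LieSubalgebra F L) : Prop :=
  ∀ x ∈ S, P.toFun x ∈ S

/-- `⟨s⟩_p`: the restricted subalgebra generated by a subset `s` of `L`, that is, the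
intersection of all restricted subalgebras containing `s`. -/
def closure (P : PMapping p F L) (s : Set L) : LieSubalgebra F L :=
  sInf {S : LieSubalgebra F L | P.IsRestricted S ∧ s ⊆ (S : Set L)}

/-- `M` is maximal in `S`, in the lattice of restricted subalgebras: both are restricted
subalgebras, `M` is properly contained in `S`, and no restricted subalgebra lies strictly
between them. -/
def IsMaximalIn (P : PMapping p F L) (M S : LieSubalgebra F L) : Prop :=
  P.IsRestricted M ∧ P.IsRestricted S ∧ M < S ∧
    ∀ N : LieSubalgebra F L, P.IsRestricted N → M ≤ N → N ≤ S → N = M ∨ N = S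

/-- A restricted subalgebra `S` is upper semimodular in `L` if `S` is maximal in `⟨S, T⟩_p` for
every restricted subalgebra `T` such that `S ∩ T` is maximal in `T`. -/
def IsUpperSemimodularIn (P : PMapping p F L) (S : LieSubalgebra F L) : Prop :=
  ∀ T : LieSubalgebra F L, P.IsRestricted T → P.IsMaximalIn (S ⊓ T) T →
    P.IsMaximalIn S (P.closure ((S : Set L) ∪ (T : Set L)))

/-- The restricted Lie algebra `L` is upper semimodular if all of its restricted subalgebras
are upper semimodular in `L`. -/
def IsUpperSemimodular (P : PMapping p F L) : Prop :=
  ∀ S : LieSubalgebra F L, P.IsRestricted S → P.IsUpperSemimodularIn S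

/-- `x` is `p`-nilpotent of order `n`: `n` is the least positive integer with `x^[p]^n = 0`. -/
def IsPNilpotentOfOrder (P : PMapping p F L) (x : L) (n : ℕ) : Prop :=
  IsLeast {m : ℕ | 0 < m ∧ P.toFun^[m] x = 0} n

end PMapping

/-- `L` is almost abelian: `L = F x ∔ A` (as a vector space) with `A` an abelian ideal on which
`ad x` acts as the identity. -/
def IsAlmostAbelian (F L : Type*) [Field F] [LieRing L] [LieAlgebra F L] : Prop :=
  ∃ (x : L) (A : LieIdeal F L), x ≠ 0 ∧ IsLieAbelian A ∧
    IsCompl (Submodule.span F {x}) A.toSubmodule ∧ ∀ a ∈ A, ⁅x, a⁆ = a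

end RestrictedLie

/-! Call `t` toral if `t^[p] = t`, and let `K` be the set of `a` with `a^[p] = 0`. Toral elements
and elements of `K` span restricted lines, so upper semimodularity makes one such line maximal in
the restricted subalgebra generated by it and another. If `t` is toral and `F t` is maximal in `M`
but `t` is not central there, then `M = F t + F f` with `f` in `K` an eigenvector of `t`
(`exists_nilpotent_of_isMaximalIn`). Hence elements of `K` commute (`lie_eq_zero`), `K` is a
subspace, toral elements act on it by scalars, and two noncommuting toral elements produce an
element of `K` that does not commute with the first.

Over an algebraically closed field the `p`-mapping on an abelian restricted subalgebra is
Frobenius-semilinear and has a Fitting decomposition, so every element is a combination of toral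
elements plus a `p`-nilpotent element.

If some toral `t` acts nontrivially on `K`, scale it to act as the identity. Then no nonzero element
of `K` is a `p`-th power (`false_of_toFun_eq`), so `p`-nilpotent elements lie in `K`; toral elements
lie in `F t + K`, and `L = F t + K` is almost abelian. Otherwise toral elements commute with one
another, hence are central. Then toral elements and `K` generate the abelian `B`, and the remaining
`p`-nilpotent elements supply the `x i`. The abelian alternative never has to be chosen. -/

/-! ### Fixed vectors of Frobenius-semilinear maps -/

open Polynomial in
/-- Additive polynomials built by the Frobenius recursion have a nonzero fixed point. -/
theorem exists_ne_zero_frobenius_recursion {F : Type*} [Field F] [IsAlgClosed F] {p : ℕ}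
    (hp : 2 ≤ p) (a : ℕ → F) (n : ℕ) (ha : ∃ i ≤ n, a i ≠ 0) :
    ∃ c : ℕ → F, c 0 = a 0 * c n ^ p ∧ (∀ i, c (i + 1) = c i ^ p + a (i + 1) * c n ^ p) ∧
      c n ≠ 0 := by
  -- The variable `X` stands for `c n`, and `q i` expresses `c i` through it; what is needed is a
  -- nonzero root of `q n = X`.
  let q : ℕ → F[X] := fun i => Nat.rec (C (a 0) * X ^ p) (fun i r => r ^ p + C (a (i + 1)) * X ^ p) i
  have q0 : q 0 = C (a 0) * X ^ p := rfl
  have qs : ∀ i, q (i + 1) = q i ^ p + C (a (i + 1)) * X ^ p := fun _ => rfl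
  have hX : (X : F[X]) ≠ 0 := X_ne_zero
  have hdvd : ∀ i, X ^ p ∣ q i := by
    intro i
    induction i with
    | zero => exact q0 ▸ Dvd.intro_left _ rfl
    | succ i ih =>
      rw [qs]
      exact dvd_add (dvd_pow ih (by omega)) (Dvd.intro_left _ rfl)
  have hstep : ∀ i, q (i + 1) = 0 → q i = 0 ∧ a (i + 1) = 0 := by
    intro i hi
    obtain ⟨d, hd⟩ := hdvd i
    rw [qs, hd] at hi
    -- After removing `X ^ p`, the Frobenius term still vanishes at `0`, so `a (i + 1)` is the
    -- constant term.
    have h1 : X ^ p * (X ^ (p * (p - 1)) * d ^ p + C (a (i + 1))) = 0 := by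
      rw [← hi, mul_pow, ← pow_mul]
      have : p * p = p + p * (p - 1) := by
        obtain ⟨k, rfl⟩ := Nat.exists_eq_add_of_le hp
        simp only [show 2 + k - 1 = k + 1 by omega]
        ring
      rw [this, pow_add]
      ring
    have h2 := (mul_eq_zero.mp h1).resolve_left (pow_ne_zero _ hX)
    have hpos : p * (p - 1) ≠ 0 := by
      have : p - 1 ≠ 0 := by omega
      positivity
    have h3 : a (i + 1) = 0 := by
      have := congrArg (eval 0) h2
      simpa [hpos] using this
    rw [h3, C_0, add_zero, mul_eq_zero] at h2
    have h4 : d = 0 := by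
      rcases h2 with h | h
      · exact absurd h (pow_ne_zero _ hX)
      · exact pow_eq_zero_iff (by omega) |>.mp h
    exact ⟨by rw [hd, h4, mul_zero], h3⟩
  have hne : ∀ n, q n = 0 → ∀ i ≤ n, a i = 0 := by
    intro n
    induction n with
    | zero =>
      intro h i hi
      obtain rfl : i = 0 := by omega
      rw [q0, mul_eq_zero] at h
      exact C_eq_zero.mp (h.resolve_right (pow_ne_zero _ hX))
    | succ n ih =>
      intro h i hi
      obtain ⟨h1, h2⟩ := hstep n h
      rcases Nat.lt_or_ge n i with h3 | h3
      · obtain rfl : i = n + 1 := by omega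
        exact h2
      · exact ih h1 i h3
  have hqn : q n ≠ 0 := by
    intro h
    obtain ⟨i, hi, hai⟩ := ha
    exact hai (hne n h i hi)
  obtain ⟨d, hd⟩ := hdvd n
  have hd0 : d ≠ 0 := by
    rintro rfl
    exact hqn (by rw [hd, mul_zero])
  have hdeg : 0 < (X ^ (p - 1) * d).natDegree := by
    rw [natDegree_mul (pow_ne_zero _ hX) hd0, natDegree_X_pow]
    omega
  -- This is `q n = X` divided by `X`; its roots are automatically nonzero.
  have hroot : ∃ r, IsRoot (X ^ (p - 1) * d - C 1) r := by
    apply IsAlgClosed.exists_root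
    apply ne_of_gt
    rw [← natDegree_pos_iff_degree_pos, natDegree_sub_C]
    exact hdeg
  obtain ⟨r, hr⟩ := hroot
  have hr1 : r ^ (p - 1) * eval r d = 1 := by
    simpa [IsRoot, sub_eq_zero] using hr
  have hr0 : r ≠ 0 := by
    rintro rfl
    rw [zero_pow (by omega), zero_mul] at hr1
    exact zero_ne_one hr1
  have hqr : eval r (q n) = r := by
    rw [hd, eval_mul, eval_pow, eval_X]
    calc r ^ p * eval r d = r * (r ^ (p - 1) * eval r d) := by
          rw [← mul_assoc, ← pow_succ', Nat.sub_add_cancel (by omega)]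
      _ = r := by rw [hr1, mul_one]
  refine ⟨fun i => eval r (q i), ?_, ?_, ?_⟩
  · simp only [hqr, q0]; simp
  · intro i
    simp only [hqr, qs]; simp
  · simpa only [hqr] using hr0

section FrobeniusSemilinear

variable {F : Type*} [Field F] [IsAlgClosed F] {p : ℕ} [Fact p.Prime] [ExpChar F p]

/-- A Frobenius-semilinear endomorphism that is not nilpotent at some vector fixes a nonzero
vector. -/
theorem exists_fixed_of_iterate_ne_zero {V : Type*} [AddCommGroup V] [Module F V]
    [FiniteDimensional F V] (φ : V →ₛₗ[frobenius F p] V) (x : V) (hx : ∀ k, φ^[k] x ≠ 0) :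
    ∃ v, v ≠ 0 ∧ φ v = v := by
  let U : ℕ → Submodule F V := fun m => Submodule.span F ((fun i => φ^[i] x) '' (Finset.range m))
  have hex : ∃ m, φ^[m] x ∈ U m := by
    by_contra! hcon
    have hmono : Monotone U := fun a b hab =>
      Submodule.span_mono (Set.image_mono (by simpa using hab))
    have hstrict : StrictMono U := by
      apply strictMono_nat_of_lt_succ
      intro n
      refine lt_of_le_of_ne (hmono (Nat.le_succ n)) fun h => hcon n ?_
      rw [h]
      exact Submodule.subset_span ⟨n, by simp, rfl⟩
    exact not_strictMono_of_wellFoundedGT U hstrict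
  classical
  obtain ⟨n, hn⟩ : ∃ n, Nat.find hex = n + 1 := by
    refine Nat.exists_eq_succ_of_ne_zero fun h => hx 0 ?_
    have := Nat.find_spec hex
    rw [h] at this
    simpa [U] using this
  have hmin : φ^[n] x ∉ U n := Nat.find_min hex (by omega)
  have hmem : φ^[n + 1] x ∈ U (n + 1) := hn ▸ Nat.find_spec hex
  obtain ⟨b, hb⟩ := (Submodule.mem_span_image_finset_iff_exists_fun' F).mp hmem
  replace hb := hb.symm
  have hb0 : ∃ i ≤ n, b i ≠ 0 := by
    by_contra! h
    refine hx (n + 1) (hb.trans (Finset.sum_eq_zero fun i hi => ?_))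
    rw [h i (by simpa [Nat.lt_succ_iff] using hi), zero_smul]
  -- Comparing coefficients in `φ v = v` for `v = ∑ c i • φ^[i] x` gives exactly this recursion, by
  -- the first linear relation `hb` among the iterates.
  obtain ⟨c, hc0, hcs, hcn⟩ :=
    exists_ne_zero_frobenius_recursion (Fact.out : p.Prime).two_le b n hb0
  have hsum : ∀ m ≤ n, ∑ i ∈ Finset.range m, c i • φ^[i] x ∈ U m := fun m _ =>
    Submodule.sum_mem _ fun i hi =>
      Submodule.smul_mem _ _ (Submodule.subset_span ⟨i, by simpa using hi, rfl⟩)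
  refine ⟨∑ i ∈ Finset.range (n + 1), c i • φ^[i] x, fun h => hmin ?_, ?_⟩
  · rw [Finset.sum_range_succ] at h
    have h1 : c n • φ^[n] x ∈ U n := by
      rw [eq_neg_of_add_eq_zero_right h]
      exact Submodule.neg_mem _ (hsum n le_rfl)
    exact (Submodule.smul_mem_iff _ hcn).mp h1
  · have h1 : φ (∑ i ∈ Finset.range (n + 1), c i • φ^[i] x) =
        ∑ i ∈ Finset.range (n + 1), c i ^ p • φ^[i + 1] x := by
      rw [map_sum]
      refine Finset.sum_congr rfl fun i _ => ?_
      rw [map_smulₛₗ, frobenius_def, Function.iterate_succ_apply']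
    rw [h1, Finset.sum_range_succ, hb, Finset.smul_sum, Finset.sum_range_succ',
      Finset.sum_range_succ' (fun i => c i • φ^[i] x), ← add_assoc, ← Finset.sum_add_distrib]
    congr 1
    · refine Finset.sum_congr rfl fun i _ => ?_
      rw [hcs, add_smul, smul_smul, mul_comm (b _)]
    · rw [hc0, smul_smul, mul_comm]

/-- Otherwise `φ` fixes a nonzero vector modulo the span `W` of the fixed vectors. Since `φ - 1` is
onto on `W`, its representative can be corrected to a genuinely fixed vector, which then lies in
`W`. -/
theorem exists_iterate_mem_span_fixed {V : Type*} [AddCommGroup V] [Module F V]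
    [FiniteDimensional F V] (φ : V →ₛₗ[frobenius F p] V) (x : V) :
    ∃ k, φ^[k] x ∈ Submodule.span F {v | φ v = v} := by
  set W := Submodule.span F {v | φ v = v} with hW
  have hWφ : W ≤ W.comap φ := by
    rw [hW, Submodule.span_le]
    intro v hv
    have hv' : φ v = v := hv
    simp only [SetLike.mem_coe, Submodule.mem_comap, hv']
    exact Submodule.subset_span hv
  let ψ := W.mapQ W φ hWφ
  have hψ : ∀ v, ψ (W.mkQ v) = W.mkQ (φ v) := fun v => rfl
  have hψk : ∀ k v, ψ^[k] (W.mkQ v) = W.mkQ (φ^[k] v) := by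
    intro k
    induction k with
    | zero => intro v; rfl
    | succ k ih => intro v; rw [Function.iterate_succ_apply, hψ, ih, Function.iterate_succ_apply]
  by_contra! hcon
  obtain ⟨v', hv0, hv⟩ := exists_fixed_of_iterate_ne_zero ψ (W.mkQ x) fun k h => hcon k (by
    rwa [hψk, Submodule.mkQ_apply, Submodule.Quotient.mk_eq_zero] at h)
  obtain ⟨v, rfl⟩ := W.mkQ_surjective v'
  have hsurj : ∀ w ∈ W, ∃ w' ∈ W, φ w' + w = w' := by
    intro w hw
    have hstep : ∀ (c : F) (u : V), φ u = u → ∃ w' ∈ W, φ w' + c • u = w' := by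
      intro c u hu
      -- An Artin–Schreier equation, solvable over an algebraically closed field.
      obtain ⟨d, hd⟩ : ∃ d : F, d ^ p + c = d := by
        obtain ⟨d, hd⟩ := IsAlgClosed.exists_root
          (Polynomial.X ^ p + (Polynomial.C c - Polynomial.X) : Polynomial F) (by
            have hp : 1 < p := (Fact.out : p.Prime).one_lt
            have h1 : (Polynomial.C c - Polynomial.X : Polynomial F).degree ≤ 1 := by
              compute_degree
            rw [Polynomial.degree_add_eq_left_of_degree_lt (by
              rw [Polynomial.degree_X_pow]
              exact h1.trans_lt (by exact_mod_cast hp)), Polynomial.degree_X_pow]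
            exact_mod_cast (by omega : p ≠ 0))
        refine ⟨d, ?_⟩
        have hd' : d ^ p + (c - d) = 0 := by simpa [Polynomial.IsRoot] using hd
        linear_combination hd'
      refine ⟨d • u, W.smul_mem _ (Submodule.subset_span hu), ?_⟩
      rw [map_smulₛₗ, frobenius_def, hu, ← add_smul, hd]
    induction hw using Submodule.closure_induction with
    | zero => exact ⟨0, W.zero_mem, by simp⟩
    | add u v _ _ hu hv =>
      obtain ⟨u', hu1, hu2⟩ := hu
      obtain ⟨v', hv1, hv2⟩ := hv
      refine ⟨u' + v', W.add_mem hu1 hv1, ?_⟩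
      nth_rewrite 2 [← hu2, ← hv2]
      rw [map_add]
      abel
    | smul_mem c u hu => exact hstep c u hu
  rw [hψ, ← sub_eq_zero, ← map_sub, Submodule.mkQ_apply, Submodule.Quotient.mk_eq_zero] at hv
  obtain ⟨w, hw, hw'⟩ := hsurj _ hv
  have hfix : v + w ∈ W := by
    refine Submodule.subset_span ?_
    change φ (v + w) = v + w
    rw [map_add]
    nth_rewrite 2 [← hw']
    abel
  refine hv0 ?_
  rw [Submodule.mkQ_apply, Submodule.Quotient.mk_eq_zero]
  simpa using W.sub_mem hfix hw

/-- Fitting decomposition of a vector under a Frobenius-semilinear endomorphism. -/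
theorem exists_add_of_frobenius_semilinear {V : Type*} [AddCommGroup V] [Module F V]
    [FiniteDimensional F V] (φ : V →ₛₗ[frobenius F p] V) (x : V) :
    ∃ s ∈ Submodule.span F {v | φ v = v}, ∃ k, φ^[k] (x - s) = 0 := by
  -- `φ` maps the span of its fixed vectors onto itself, because scalars have `p`-th roots.
  have hlift : ∀ k, ∀ w ∈ Submodule.span F {v | φ v = v},
      ∃ s ∈ Submodule.span F {v | φ v = v}, φ^[k] s = w := by
    intro k
    induction k with
    | zero => exact fun w hw => ⟨w, hw, rfl⟩
    | succ k ih =>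
      intro w hw
      obtain ⟨s, hs, rfl⟩ := ih w hw
      have : ∃ s' ∈ Submodule.span F {v | φ v = v}, φ s' = s := by
        clear hw
        induction hs using Submodule.span_induction with
        | mem v hv => exact ⟨v, Submodule.subset_span hv, hv⟩
        | zero => exact ⟨0, Submodule.zero_mem _, map_zero _⟩
        | add u v _ _ hu hv =>
          obtain ⟨u', hu, rfl⟩ := hu
          obtain ⟨v', hv, rfl⟩ := hv
          exact ⟨u' + v', Submodule.add_mem _ hu hv, map_add _ _ _⟩
        | smul c v _ hv =>
          obtain ⟨v', hv, rfl⟩ := hv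
          obtain ⟨d, hd⟩ := IsAlgClosed.exists_pow_nat_eq c (Fact.out : p.Prime).pos
          exact ⟨d • v', Submodule.smul_mem _ _ hv, by rw [map_smulₛₗ, frobenius_def, hd]⟩
      obtain ⟨s', hs', rfl⟩ := this
      exact ⟨s', hs', rfl⟩
  obtain ⟨k, hk⟩ := exists_iterate_mem_span_fixed φ x
  obtain ⟨s, hs, hsk⟩ := hlift k _ hk
  refine ⟨s, hs, k, ?_⟩
  rw [iterate_map_sub, hsk, sub_self]

end FrobeniusSemilinear

/-! ### The `p`-mapping: restricted subalgebras, Jordan decomposition, toral eigenvectors -/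

namespace PMapping

section Basic

variable {p : ℕ} [hp : Fact p.Prime] {F L : Type*} [Field F] [LieRing L] [LieAlgebra F L]

/-- The elements that stabilise the subspace `S` and map `X` into `S`. -/
def relCentralizer (S : Submodule F L) (X : Set L) : LieSubalgebra F L where
  carrier := {z | (∀ s ∈ S, ⁅z, s⁆ ∈ S) ∧ ∀ x ∈ X, ⁅z, x⁆ ∈ S}
  add_mem' := fun {a b} ha hb =>
    ⟨fun s hs => by rw [add_lie]; exact S.add_mem (ha.1 s hs) (hb.1 s hs),
      fun s hs => by rw [add_lie]; exact S.add_mem (ha.2 s hs) (hb.2 s hs)⟩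
  zero_mem' := ⟨fun s _ => by rw [zero_lie]; exact S.zero_mem,
    fun s _ => by rw [zero_lie]; exact S.zero_mem⟩
  smul_mem' := fun c a ha =>
    ⟨fun s hs => by rw [smul_lie]; exact S.smul_mem c (ha.1 s hs),
      fun s hs => by rw [smul_lie]; exact S.smul_mem c (ha.2 s hs)⟩
  lie_mem' := fun {a b} ha hb =>
    ⟨fun s hs => by
        rw [lie_lie]; exact S.sub_mem (ha.1 _ (hb.1 s hs)) (hb.1 _ (ha.1 s hs)),
      fun s hs => by
        rw [lie_lie]; exact S.sub_mem (ha.1 _ (hb.2 s hs)) (hb.1 _ (ha.2 s hs))⟩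

theorem mem_relCentralizer {S : Submodule F L} {X : Set L} {z : L} :
    z ∈ relCentralizer S X ↔ (∀ s ∈ S, ⁅z, s⁆ ∈ S) ∧ ∀ x ∈ X, ⁅z, x⁆ ∈ S :=
  Iff.rfl

theorem mem_relCentralizer_bot {X : Set L} {z : L} :
    z ∈ relCentralizer (⊥ : Submodule F L) X ↔ ∀ x ∈ X, ⁅z, x⁆ = 0 := by
  simp [mem_relCentralizer]

theorem lie_mem_span_of_forall {G : Set L}
    (h : ∀ x ∈ G, ∀ y ∈ G, ⁅x, y⁆ ∈ Submodule.span F G) {x y : L}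
    (hx : x ∈ Submodule.span F G) (hy : y ∈ Submodule.span F G) :
    ⁅x, y⁆ ∈ Submodule.span F G := by
  induction hx, hy using Submodule.span_induction₂ with
  | mem_mem x y hx hy => exact h x hx y hy
  | zero_left y hy => rw [zero_lie]; exact Submodule.zero_mem _
  | zero_right x hx => rw [lie_zero]; exact Submodule.zero_mem _
  | add_left x y z _ _ _ h1 h2 => rw [add_lie]; exact Submodule.add_mem _ h1 h2
  | add_right x y z _ _ _ h1 h2 => rw [lie_add]; exact Submodule.add_mem _ h1 h2
  | smul_left c x y _ _ h => rw [smul_lie]; exact Submodule.smul_mem _ _ h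
  | smul_right c x y _ _ h => rw [lie_smul]; exact Submodule.smul_mem _ _ h

/-- The span of a set that is closed under brackets up to linear combinations. -/
def spanLie (F : Type*) {L : Type*} [Field F] [LieRing L] [LieAlgebra F L] (G : Set L)
    (h : ∀ x ∈ G, ∀ y ∈ G, ⁅x, y⁆ ∈ Submodule.span F G) : LieSubalgebra F L :=
  { Submodule.span F G with lie_mem' := lie_mem_span_of_forall h }

theorem mem_spanLie {G : Set L} {h : ∀ x ∈ G, ∀ y ∈ G, ⁅x, y⁆ ∈ Submodule.span F G} {x : L} :
    x ∈ spanLie F G h ↔ x ∈ Submodule.span F G :=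
  Iff.rfl

theorem spanLie_le {G : Set L} {h : ∀ x ∈ G, ∀ y ∈ G, ⁅x, y⁆ ∈ Submodule.span F G}
    {S : LieSubalgebra F L} (hS : ∀ x ∈ G, x ∈ S) : spanLie F G h ≤ S := fun _ hx =>
  (Submodule.span_le (p := S.toSubmodule)).mpr hS hx

/-- The line spanned by an element. -/
def line (F : Type*) {L : Type*} [Field F] [LieRing L] [LieAlgebra F L] (x : L) :
    LieSubalgebra F L :=
  spanLie F {x} (by
    rintro _ rfl _ rfl
    rw [lie_self]
    exact Submodule.zero_mem _)

theorem mem_line {x y : L} : y ∈ line F x ↔ ∃ c : F, c • x = y :=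
  Submodule.mem_span_singleton

theorem self_mem_line (x : L) : x ∈ line F x := mem_line.mpr ⟨1, one_smul _ _⟩

theorem line_le {x : L} {S : LieSubalgebra F L} (hx : x ∈ S) : line F x ≤ S :=
  spanLie_le (by rintro _ rfl; exact hx)

theorem _root_.jacobsonCoeff_mem {S : LieSubalgebra F L} {x y : L} (hx : x ∈ S) (hy : y ∈ S) :
    ∀ n k, jacobsonCoeff x y n k ∈ S
  | 0, 0 => by rw [jacobsonCoeff]; exact hx
  | 0, _ + 1 => by rw [jacobsonCoeff]; exact S.zero_mem
  | n + 1, 0 => by rw [jacobsonCoeff]; exact S.lie_mem hy (jacobsonCoeff_mem hx hy n 0)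
  | n + 1, k + 1 => by
    rw [jacobsonCoeff]
    exact S.add_mem (S.lie_mem hx (jacobsonCoeff_mem hx hy n k))
      (S.lie_mem hy (jacobsonCoeff_mem hx hy n (k + 1)))

theorem _root_.jacobsonCoeff_succ_of_lie_eq_zero {x y : L} (h : ⁅x, y⁆ = 0) :
    ∀ n k, jacobsonCoeff x y (n + 1) k = 0 := by
  have h' : ⁅y, x⁆ = 0 := by rw [← lie_skew, h, neg_zero]
  intro n
  induction n with
  | zero =>
    intro k
    match k with
    | 0 => simp [jacobsonCoeff, h']
    | 1 => simp [jacobsonCoeff]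
    | k + 2 => simp [jacobsonCoeff]
  | succ n ih =>
    intro k
    cases k <;> rw [jacobsonCoeff] <;> simp [ih]

/-- `ad(X t + y)` sends `t` to `-y` and then multiplies by `X` at each step. -/
theorem _root_.jacobsonCoeff_succ_of_lie_eq_self {t y : L} (h : ⁅t, y⁆ = y) :
    ∀ n k, jacobsonCoeff t y (n + 1) k = if k = n then -y else 0 := by
  have h' : ⁅y, t⁆ = -y := by rw [← lie_skew, h]
  intro n
  induction n with
  | zero =>
    intro k
    match k with
    | 0 => simp [jacobsonCoeff, h']
    | 1 => simp [jacobsonCoeff]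
    | k + 2 => simp [jacobsonCoeff]
  | succ n ih =>
    intro k
    cases k with
    | zero =>
      rw [jacobsonCoeff, ih]
      split_ifs <;> simp_all
    | succ k =>
      rw [jacobsonCoeff, ih, ih]
      by_cases h1 : k = n <;> by_cases h2 : k + 1 = n <;> simp [h1, h2, h]

variable (P : PMapping p F L)

theorem toFun_zero : P.toFun 0 = 0 := by
  have := P.toFun_smul 0 0
  rwa [zero_smul, zero_pow hp.out.ne_zero, zero_smul] at this

omit hp in
theorem lie_toFun (x z : L) : ⁅P.toFun x, z⁆ = (LieAlgebra.ad F L x ^ p) z := by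
  rw [← P.ad_toFun, LieAlgebra.ad_apply]

theorem lie_toFun_mem {x z : L} (S : Submodule F L) (hS : ∀ s ∈ S, ⁅x, s⁆ ∈ S)
    (hz : ⁅x, z⁆ ∈ S) : ⁅P.toFun x, z⁆ ∈ S := by
  obtain ⟨q, hq⟩ := Nat.exists_eq_succ_of_ne_zero hp.out.ne_zero
  have : ∀ n, ∀ s ∈ S, (LieAlgebra.ad F L x ^ n) s ∈ S := by
    intro n
    induction n with
    | zero => exact fun s hs => hs
    | succ n ih =>
      intro s hs
      rw [pow_succ]
      exact ih _ (hS s hs)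
  rw [lie_toFun, hq, pow_succ]
  exact this q _ hz

theorem lie_toFun_eq_zero {x z : L} (h : ⁅x, z⁆ = 0) : ⁅P.toFun x, z⁆ = 0 := by
  have := P.lie_toFun_mem (x := x) (z := z) ⊥ (by simp) (by simpa using h)
  simpa using this

theorem lie_toFun_eq_zero_of_lie_lie {x z : L} (h : ⁅x, ⁅x, z⁆⁆ = 0) : ⁅P.toFun x, z⁆ = 0 := by
  obtain ⟨q, hq⟩ := Nat.exists_eq_add_of_le' hp.out.two_le
  rw [lie_toFun, hq, pow_add, pow_two]
  simp [h]

omit hp in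
theorem lie_toFun_eq_smul {x z : L} {c : F} (h : ⁅x, z⁆ = c • z) :
    ⁅P.toFun x, z⁆ = c ^ p • z := by
  rw [lie_toFun]
  have : ∀ n, (LieAlgebra.ad F L x ^ n) z = c ^ n • z := by
    intro n
    induction n with
    | zero => simp
    | succ n ih => rw [pow_succ', Module.End.mul_apply, ih, map_smul, LieAlgebra.ad_apply, h,
        smul_smul, pow_succ]
  exact this p

theorem toFun_add_of_lie_eq_zero {x y : L} (h : ⁅x, y⁆ = 0) :
    P.toFun (x + y) = P.toFun x + P.toFun y := by
  obtain ⟨q, hq⟩ := Nat.exists_eq_add_of_le' hp.out.two_le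
  rw [P.toFun_add, Finset.sum_eq_zero, add_zero]
  intro i _
  rw [jacobsonS, show p - 1 = q + 1 by omega, jacobsonCoeff_succ_of_lie_eq_zero h, smul_zero]

theorem toFun_add_of_lie_eq_self [CharP F p] {t y : L} (h : ⁅t, y⁆ = y) :
    P.toFun (t + y) = P.toFun t + P.toFun y + y := by
  obtain ⟨q, hq⟩ := Nat.exists_eq_add_of_le' hp.out.two_le
  rw [P.toFun_add, Finset.sum_eq_single_of_mem (p - 1) (by simp; omega)]
  · have h1 : ((p - 1 : ℕ) : F) = -1 := by
      rw [Nat.cast_sub hp.out.one_le, CharP.cast_eq_zero]; simp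
    rw [jacobsonS, h1, show p - 1 = q + 1 by omega, jacobsonCoeff_succ_of_lie_eq_self h]
    simp
  · intro i hi hne
    rw [Finset.mem_Icc] at hi
    rw [jacobsonS, show p - 1 = q + 1 by omega, jacobsonCoeff_succ_of_lie_eq_self h,
      if_neg (by omega), smul_zero]

omit hp in
variable {P} in
theorem IsRestricted.inf {S T : LieSubalgebra F L} (hS : P.IsRestricted S)
    (hT : P.IsRestricted T) : P.IsRestricted (S ⊓ T) := fun x hx =>
  ⟨hS x hx.1, hT x hx.2⟩

theorem isRestricted_relCentralizer (S : Submodule F L) (X : Set L) :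
    P.IsRestricted (relCentralizer S X) := fun _ hx =>
  ⟨fun s hs => P.lie_toFun_mem S hx.1 (hx.1 s hs), fun s hs => P.lie_toFun_mem S hx.1 (hx.2 s hs)⟩

/-- The Jacobson corrections are iterated brackets and stay in the subalgebra, so closure under the
`p`-mapping need only be checked on generators. -/
theorem isRestricted_spanLie {G : Set L} (h : ∀ x ∈ G, ∀ y ∈ G, ⁅x, y⁆ ∈ Submodule.span F G)
    (hG : ∀ x ∈ G, P.toFun x ∈ Submodule.span F G) : P.IsRestricted (spanLie F G h) := by
  intro x hx
  rw [mem_spanLie] at hx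
  induction hx using Submodule.span_induction with
  | mem x hx => exact hG x hx
  | zero => rw [toFun_zero]; exact Submodule.zero_mem _
  | add x y hx hy h1 h2 =>
    rw [P.toFun_add]
    refine LieSubalgebra.add_mem _ (LieSubalgebra.add_mem _ h1 h2) (sum_mem fun i _ => ?_)
    exact LieSubalgebra.smul_mem _ _ (jacobsonCoeff_mem (S := spanLie F G h) hx hy _ _)
  | smul c x _ h1 => rw [P.toFun_smul]; exact LieSubalgebra.smul_mem _ _ h1

theorem isRestricted_line {x : L} (hx : P.toFun x ∈ line F x) : P.IsRestricted (line F x) :=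
  P.isRestricted_spanLie _ (by rintro _ rfl; exact hx)

omit hp in
theorem mem_closure {s : Set L} {x : L} :
    x ∈ P.closure s ↔ ∀ S : LieSubalgebra F L, P.IsRestricted S → s ⊆ (S : Set L) → x ∈ S := by
  rw [← SetLike.mem_coe, closure, LieSubalgebra.coe_sInf]
  simp

omit hp in
theorem subset_closure (s : Set L) : s ⊆ P.closure s := fun _ hx =>
  P.mem_closure.mpr fun _ _ hS => hS hx

omit hp in
theorem isRestricted_closure (s : Set L) : P.IsRestricted (P.closure s) := fun x hx =>
  P.mem_closure.mpr fun S hS hs => hS x (P.mem_closure.mp hx S hS hs)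

omit hp in
variable {P} in
theorem closure_le {s : Set L} {S : LieSubalgebra F L} (hS : P.IsRestricted S)
    (h : s ⊆ (S : Set L)) : P.closure s ≤ S := sInf_le ⟨hS, h⟩

/-- Centralisers are restricted, so the closure can be taken in one argument at a time. -/
theorem lie_eq_zero_of_mem_closure {s : Set L} (h : ∀ x ∈ s, ∀ y ∈ s, ⁅x, y⁆ = 0) :
    ∀ x ∈ P.closure s, ∀ y ∈ P.closure s, ⁅x, y⁆ = 0 := by
  have h1 : P.closure s ≤ relCentralizer ⊥ s :=
    closure_le (P.isRestricted_relCentralizer _ _) fun x hx => mem_relCentralizer_bot.mpr (h x hx)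
  have h2 : P.closure s ≤ relCentralizer ⊥ (P.closure s : Set L) :=
    closure_le (P.isRestricted_relCentralizer _ _) fun x hx => mem_relCentralizer_bot.mpr
      fun y hy => by rw [← lie_skew, mem_relCentralizer_bot.mp (h1 hy) x hx, neg_zero]
  exact fun x hx y hy => mem_relCentralizer_bot.mp (h2 hx) y hy

/-- The restriction of the `p`-mapping to an abelian restricted subalgebra. -/
def frobeniusRestrict [ExpChar F p] (C : LieSubalgebra F L) (hC : P.IsRestricted C)
    (hab : ∀ x ∈ C, ∀ y ∈ C, ⁅x, y⁆ = 0) : C →ₛₗ[frobenius F p] C where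
  toFun x := ⟨P.toFun x, hC x x.2⟩
  map_add' x y := Subtype.ext (P.toFun_add_of_lie_eq_zero (hab x x.2 y y.2))
  map_smul' c x := Subtype.ext (P.toFun_smul c x)

theorem coe_iterate_frobeniusRestrict [ExpChar F p] (C : LieSubalgebra F L)
    (hC : P.IsRestricted C) (hab : ∀ x ∈ C, ∀ y ∈ C, ⁅x, y⁆ = 0) (k : ℕ) (x : C) :
    (((P.frobeniusRestrict C hC hab)^[k] x : C) : L) = P.toFun^[k] x := by
  induction k generalizing x with
  | zero => rfl
  | succ k ih => rw [Function.iterate_succ_apply, Function.iterate_succ_apply, ih]; rfl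

theorem coe_mem_span_of_frobeniusRestrict [ExpChar F p] (C : LieSubalgebra F L)
    (hC : P.IsRestricted C) (hab : ∀ x ∈ C, ∀ y ∈ C, ⁅x, y⁆ = 0) {w : C}
    (hw : w ∈ Submodule.span F {v | P.frobeniusRestrict C hC hab v = v}) :
    (w : L) ∈ Submodule.span F {t | P.toFun t = t ∧ t ∈ C} := by
  refine Submodule.span_mono ?_
    (Submodule.apply_mem_span_image_of_mem_span C.toSubmodule.subtype hw)
  rintro _ ⟨v, hv, rfl⟩
  exact ⟨congrArg Subtype.val hv, v.2⟩

/-- Additive Jordan decomposition with respect to the `p`-mapping. -/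
theorem exists_toral_add_nilpotent [CharP F p] [IsAlgClosed F] [FiniteDimensional F L] (x : L) :
    ∃ s ∈ Submodule.span F {t | P.toFun t = t ∧ t ∈ P.closure {x}},
      ∃ k, P.toFun^[k] (x - s) = 0 := by
  have : ExpChar F p := ExpChar.prime hp.out
  have hab := P.lie_eq_zero_of_mem_closure (s := {x}) (by rintro _ rfl _ rfl; exact lie_self _)
  obtain ⟨s, hs, k, hk⟩ := exists_add_of_frobenius_semilinear
    (P.frobeniusRestrict _ (P.isRestricted_closure {x}) hab) ⟨x, P.subset_closure _ rfl⟩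
  refine ⟨s, P.coe_mem_span_of_frobeniusRestrict _ _ _ hs, k, ?_⟩
  have := congrArg Subtype.val hk
  rwa [coe_iterate_frobeniusRestrict] at this

theorem exists_iterate_mem_span_toral [CharP F p] [IsAlgClosed F] [FiniteDimensional F L] (x : L) :
    ∃ k, P.toFun^[k] x ∈ Submodule.span F {t | P.toFun t = t} := by
  have : ExpChar F p := ExpChar.prime hp.out
  have hab := P.lie_eq_zero_of_mem_closure (s := {x}) (by rintro _ rfl _ rfl; exact lie_self _)
  obtain ⟨k, hk⟩ := exists_iterate_mem_span_fixed
    (P.frobeniusRestrict _ (P.isRestricted_closure {x}) hab) ⟨x, P.subset_closure _ rfl⟩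
  refine ⟨k, ?_⟩
  have := P.coe_mem_span_of_frobeniusRestrict _ _ _ hk
  rw [coe_iterate_frobeniusRestrict] at this
  exact Submodule.span_mono (fun t ht => ht.1) this

/-- Each application of the `p`-mapping to `z` raises its eigenvalue on `x` to the `p`-th power. -/
theorem eq_zero_of_iterate_eq_zero {z x : L} {c : F} (hx : x ≠ 0) (h : ⁅z, x⁆ = c • x) {k : ℕ}
    (hk : P.toFun^[k] z = 0) : c = 0 := by
  induction k generalizing z c with
  | zero =>
    rw [Function.iterate_zero_apply] at hk
    rw [hk, zero_lie] at h
    exact (smul_eq_zero.mp h.symm).resolve_right hx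
  | succ k ih =>
    rw [Function.iterate_succ_apply] at hk
    exact pow_eq_zero_iff hp.out.ne_zero |>.mp (ih (P.lie_toFun_eq_smul h) hk)

omit hp in
theorem eigenvalue_pow {t e : L} {c : F} (ht : P.toFun t = t) (he : e ≠ 0) (h : ⁅t, e⁆ = c • e) :
    c ^ p = c := by
  have := P.lie_toFun_eq_smul h
  rw [ht, h] at this
  exact (smul_left_injective F he this).symm

omit hp in
theorem toFun_smul_of_pow_eq {t : L} {c : F} (ht : P.toFun t = t) (hc : c ^ p = c) :
    P.toFun (c • t) = c • t := by
  rw [P.toFun_smul, ht, hc]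

-- `ad t` is a root of the separable polynomial `X ^ p - X`, hence diagonalisable on `M`; its
-- eigenvectors cannot all lie in `S`.
omit hp in
theorem exists_eigenvector [CharP F p] [IsAlgClosed F] [FiniteDimensional F L] {t : L}
    (ht : P.toFun t = t) (M : LieSubalgebra F L) (htM : t ∈ M) (S : Submodule F L) {w : L}
    (hwM : w ∈ M) (hwS : w ∉ S) : ∃ (μ : F) (f : L), f ∈ M ∧ ⁅t, f⁆ = μ • f ∧ f ∉ S := by
  by_contra! hcon
  let T : Module.End F M := LieAlgebra.ad F M ⟨t, htM⟩
  have hTn : ∀ n (v : M), (((T ^ n) v : M) : L) = (LieAlgebra.ad F L t ^ n) v := by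
    intro n
    induction n with
    | zero => intro v; rfl
    | succ n ih => intro v; rw [pow_succ, pow_succ, Module.End.mul_apply, ih]; rfl
  have hT : T ^ p = T := by
    ext v
    rw [hTn, ← P.ad_toFun, ht]
    rfl
  have hss : T.IsSemisimple := by
    refine Module.End.isSemisimple_of_squarefree_aeval_eq_zero
      (galois_poly_separable (K := F) p p dvd_rfl).squarefree ?_
    simp [hT]
  have htop : ⨆ μ, T.eigenspace μ = ⊤ := by
    rw [← Module.End.iSup_maxGenEigenspace_eq_top T]
    simp_rw [hss.isFinitelySemisimple.maxGenEigenspace_eq_eigenspace]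
  have hle : ⨆ μ, T.eigenspace μ ≤ S.comap M.toSubmodule.subtype := by
    refine iSup_le fun μ v hv => ?_
    rw [Module.End.mem_eigenspace_iff] at hv
    exact hcon μ v v.2 (congrArg Subtype.val hv)
  rw [htop] at hle
  exact hwS (hle (Submodule.mem_top (x := ⟨w, hwM⟩)))

end Basic

end PMapping

/-! ### Consequences of upper semimodularity for toral elements and for `K` -/

namespace PMapping

section UpperSemimodular

variable {p : ℕ} [hp : Fact p.Prime] {F L : Type*} [Field F] [LieRing L] [LieAlgebra F L]
  {P : PMapping p F L}

theorem line_isRestricted_of_toral {t : L} (ht : P.toFun t = t) : P.IsRestricted (line F t) :=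
  P.isRestricted_line (by rw [ht]; exact self_mem_line t)

theorem line_isRestricted_of_eq_zero {e : L} (he : P.toFun e = 0) : P.IsRestricted (line F e) :=
  P.isRestricted_line (by rw [he]; exact LieSubalgebra.zero_mem _)

omit hp in
/-- A subalgebra of codimension one in `T` lies maximally in `T`; by upper semimodularity this
passes to joins. -/
theorem IsUpperSemimodular.isMaximalIn (hL : P.IsUpperSemimodular) {S T : LieSubalgebra F L}
    (hS : P.IsRestricted S) (hT : P.IsRestricted T) {y : L} (hyT : y ∈ T) (hyS : y ∉ S)
    (h : ∀ z ∈ T, ∃ m ∈ S ⊓ T, ∃ c : F, z = m + c • y) :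
    P.IsMaximalIn S (P.closure ((S : Set L) ∪ (T : Set L))) := by
  refine hL S hS T hT ⟨hS.inf hT, hT, ?_, ?_⟩
  · refine lt_of_le_of_ne inf_le_right fun heq => hyS ?_
    rw [← heq] at hyT
    exact hyT.1
  · intro N _ hN1 hN2
    by_cases hle : N ≤ S ⊓ T
    · exact Or.inl (le_antisymm hle hN1)
    · right
      obtain ⟨z, hzN, hz⟩ := SetLike.not_le_iff_exists.mp hle
      obtain ⟨m, hm, c, rfl⟩ := h z (hN2 hzN)
      have hc : c ≠ 0 := by
        rintro rfl
        exact hz (by simpa using hm)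
      have hy : y ∈ N := by
        have := N.smul_mem c⁻¹ (N.sub_mem hzN (hN1 hm))
        rwa [add_sub_cancel_left, smul_smul, inv_mul_cancel₀ hc, one_smul] at this
      refine le_antisymm hN2 fun w hw => ?_
      obtain ⟨m, hm, c, rfl⟩ := h w hw
      exact N.add_mem (hN1 hm) (N.smul_mem c hy)

omit hp in
theorem IsUpperSemimodular.isMaximalIn_line (hL : P.IsUpperSemimodular) {S : LieSubalgebra F L}
    (hS : P.IsRestricted S) {y : L} (hy : P.IsRestricted (line F y)) (hyS : y ∉ S) :
    P.IsMaximalIn S (P.closure ((S : Set L) ∪ (line F y : Set L))) :=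
  hL.isMaximalIn hS hy (self_mem_line y) hyS fun z hz => by
    obtain ⟨c, rfl⟩ := mem_line.mp hz
    exact ⟨0, LieSubalgebra.zero_mem _, c, by simp⟩

omit hp in
theorem lie_lie_eq_zero_of_lie_eq_smul {t f : L} {c : F} (h : ⁅t, f⁆ = c • f) :
    ⁅f, ⁅f, t⁆⁆ = 0 := by
  rw [← lie_skew f t, h, lie_neg, lie_smul, lie_self, smul_zero, neg_zero]

theorem lie_mem_span_pair {x y : L} {c : F} (h : ⁅x, y⁆ = c • y) :
    ∀ u ∈ ({x, y} : Set L), ∀ v ∈ ({x, y} : Set L), ⁅u, v⁆ ∈ Submodule.span F ({x, y} : Set L) := by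
  have hy : y ∈ Submodule.span F ({x, y} : Set L) := Submodule.subset_span (by simp)
  rintro u (rfl | rfl) v (rfl | rfl)
  · rw [lie_self]; exact Submodule.zero_mem _
  · rw [h]; exact Submodule.smul_mem _ _ hy
  · rw [← lie_skew, h]; exact Submodule.neg_mem _ (Submodule.smul_mem _ _ hy)
  · rw [lie_self]; exact Submodule.zero_mem _

variable [CharP F p] [IsAlgClosed F] [FiniteDimensional F L]

/-- If a toral line is maximal in `M` and not central there, then `M` is the two-dimensional
almost abelian algebra. -/
theorem exists_nilpotent_of_isMaximalIn {t w : L} {M : LieSubalgebra F L} (ht : P.toFun t = t)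
    (hM : P.IsMaximalIn (line F t) M) (hw : w ∈ M) (htw : ⁅t, w⁆ ≠ 0) :
    ∃ (f : L) (μ : F), μ ≠ 0 ∧ f ≠ 0 ∧ P.toFun f = 0 ∧ ⁅t, f⁆ = μ • f ∧
      ∀ z ∈ M, ∃ a b : F, a • t + b • f = z := by
  obtain ⟨-, hMr, hlt, hmax⟩ := hM
  have htM : t ∈ M := hlt.le (self_mem_line t)
  obtain ⟨μ, f, hfM, hf, hfk⟩ := P.exists_eigenvector ht M htM (LieAlgebra.ad F L t).ker hw
    (by simpa using htw)
  rw [LinearMap.mem_ker, LieAlgebra.ad_apply, hf] at hfk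
  have hμ : μ ≠ 0 := fun h => hfk (by rw [h, zero_smul])
  have hf0 : f ≠ 0 := fun h => hfk (by rw [h, smul_zero])
  have hC : M ⊓ relCentralizer ⊥ {t} = line F t := by
    refine (hmax _ (hMr.inf (P.isRestricted_relCentralizer _ _)) ?_ inf_le_left).resolve_right ?_
    · refine line_le ⟨htM, mem_relCentralizer_bot.mpr ?_⟩
      rintro _ rfl
      exact lie_self _
    · intro h
      have := mem_relCentralizer_bot.mp (h.ge hw).2 t rfl
      exact htw (by rw [← lie_skew, this, neg_zero])
  -- `f^[p]` commutes with `t`, so it is a multiple of `t`; it also commutes with `f`, while `t`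
  -- does not, so it vanishes.
  have hPf : P.toFun f ∈ line F t := by
    rw [← hC]
    refine ⟨hMr f hfM, mem_relCentralizer_bot.mpr ?_⟩
    rintro _ rfl
    exact P.lie_toFun_eq_zero_of_lie_lie (lie_lie_eq_zero_of_lie_eq_smul hf)
  have hPf0 : P.toFun f = 0 := by
    obtain ⟨c, hc⟩ := mem_line.mp hPf
    have := P.lie_toFun_eq_zero (lie_self f)
    rw [← hc, smul_lie, hf] at this
    rw [← hc, (smul_eq_zero.mp this).resolve_right hfk, zero_smul]
  refine ⟨f, μ, hμ, hf0, hPf0, hf, ?_⟩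
  have hN : spanLie F {t, f} (lie_mem_span_pair hf) = M := by
    refine (hmax _ (P.isRestricted_spanLie _ ?_) ?_ ?_).resolve_left ?_
    · rintro u (rfl | rfl)
      · rw [ht]; exact Submodule.subset_span (by simp)
      · rw [hPf0]; exact Submodule.zero_mem _
    · exact line_le (Submodule.subset_span (by simp))
    · refine spanLie_le ?_
      rintro u (rfl | rfl)
      exacts [htM, hfM]
    · intro h
      have : f ∈ line F t := h.le (Submodule.subset_span (by simp))
      obtain ⟨c, rfl⟩ := mem_line.mp this
      rw [lie_smul, lie_self, smul_zero] at hf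
      exact hfk hf.symm
  intro z hz
  rw [← hN, mem_spanLie, Submodule.mem_span_pair] at hz
  exact hz

omit [CharP F p] [IsAlgClosed F] [FiniteDimensional F L] in
theorem eq_zero_of_toFun_eq_zero {t f : L} {μ a b : F} (hμ : μ ≠ 0) (hf0 : f ≠ 0)
    (hf : ⁅t, f⁆ = μ • f) (h : P.toFun (a • t + b • f) = 0) : a = 0 := by
  have h1 : ⁅a • t + b • f, f⁆ = (a * μ) • f := by
    rw [add_lie, smul_lie, smul_lie, lie_self, hf, smul_zero, add_zero, smul_smul]
  have := P.eq_zero_of_iterate_eq_zero (k := 1) hf0 h1 h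
  exact (mul_eq_zero.mp this).resolve_right hμ

theorem IsUpperSemimodular.exists_eigenvalue (hL : P.IsUpperSemimodular) {t e : L}
    (ht : P.toFun t = t) (he : P.toFun e = 0) : ∃ c : F, ⁅t, e⁆ = c • e := by
  by_cases hte : ⁅t, e⁆ = 0
  · exact ⟨0, by rw [hte, zero_smul]⟩
  have hM := hL.isMaximalIn_line (line_isRestricted_of_toral ht) (line_isRestricted_of_eq_zero he)
    (fun h => hte (by
      obtain ⟨c, rfl⟩ := mem_line.mp h
      rw [lie_smul, lie_self, smul_zero]))
  have heM : e ∈ P.closure ((line F t : Set L) ∪ (line F e : Set L)) :=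
    P.subset_closure _ (Or.inr (self_mem_line e))
  obtain ⟨f, μ, hμ, hf0, -, hf, hall⟩ := exists_nilpotent_of_isMaximalIn ht hM heM hte
  obtain ⟨a, b, rfl⟩ := hall e heM
  have ha := eq_zero_of_toFun_eq_zero hμ hf0 hf he
  exact ⟨μ, by rw [ha, zero_smul, zero_add, lie_smul, hf, smul_comm]⟩

theorem IsUpperSemimodular.exists_of_toral (hL : P.IsUpperSemimodular) {t u : L}
    (ht : P.toFun t = t) (hu : P.toFun u = u) (htu : ⁅t, u⁆ ≠ 0) :
    ∃ f, P.toFun f = 0 ∧ ⁅t, f⁆ ≠ 0 ∧ ∃ a b : F, a • t + b • f = u := by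
  have hM := hL.isMaximalIn_line (line_isRestricted_of_toral ht) (line_isRestricted_of_toral hu)
    (fun h => htu (by
      obtain ⟨c, rfl⟩ := mem_line.mp h
      rw [lie_smul, lie_self, smul_zero]))
  have huM : u ∈ P.closure ((line F t : Set L) ∪ (line F u : Set L)) :=
    P.subset_closure _ (Or.inr (self_mem_line u))
  obtain ⟨f, μ, hμ, hf0, hPf, hf, hall⟩ := exists_nilpotent_of_isMaximalIn ht hM huM htu
  exact ⟨f, hPf, by rw [hf]; exact smul_ne_zero hμ hf0, hall u huM⟩

/-- Two elements with vanishing `p`-th power commute. -/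
theorem IsUpperSemimodular.lie_eq_zero (hL : P.IsUpperSemimodular) {x y : L}
    (hx : P.toFun x = 0) (hy : P.toFun y = 0) : ⁅x, y⁆ = 0 := by
  by_contra hxy
  have hx0 : x ≠ 0 := fun h => hxy (by rw [h, zero_lie])
  have hyx : y ∉ line F x := fun h => hxy (by
    obtain ⟨c, rfl⟩ := mem_line.mp h
    rw [lie_smul, lie_self, smul_zero])
  obtain ⟨-, hMr, hlt, hmax⟩ := hL.isMaximalIn_line (line_isRestricted_of_eq_zero hx)
    (line_isRestricted_of_eq_zero hy) hyx
  set M := P.closure ((line F x : Set L) ∪ (line F y : Set L))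
  have hxM : x ∈ M := hlt.le (self_mem_line x)
  have hyM : y ∈ M := P.subset_closure _ (Or.inr (self_mem_line y))
  -- `ad x` is nilpotent; `z` is the last iterate on `y` outside the line of `x`.
  obtain ⟨z, hzM, hzx, c, hc⟩ : ∃ z ∈ M, z ∉ line F x ∧ ∃ c : F, ⁅x, z⁆ = c • x := by
    have hM : ∀ n, (LieAlgebra.ad F L x ^ n) y ∈ M := by
      intro n
      induction n with
      | zero => exact hyM
      | succ n ih => rw [pow_succ', Module.End.mul_apply]; exact M.lie_mem hxM ih
    classical
    have hex : ∃ n, (LieAlgebra.ad F L x ^ n) y ∈ line F x :=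
      ⟨p, by rw [← P.lie_toFun, hx, zero_lie]; exact LieSubalgebra.zero_mem _⟩
    obtain ⟨n, hn⟩ := Nat.exists_eq_succ_of_ne_zero (n := Nat.find hex) fun h => hyx (by
      have := Nat.find_spec hex
      rwa [h] at this)
    refine ⟨_, hM n, Nat.find_min hex (by omega), ?_⟩
    have := Nat.find_spec hex
    rw [hn, pow_succ', Module.End.mul_apply] at this
    obtain ⟨c, hc⟩ := mem_line.mp this
    exact ⟨c, hc.symm⟩
  by_cases hc0 : c = 0
  · have hN : relCentralizer ⊥ {x} ⊓ M = M := by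
      refine (hmax _ ((P.isRestricted_relCentralizer _ _).inf hMr) ?_ inf_le_right).resolve_left ?_
      · refine line_le ⟨mem_relCentralizer_bot.mpr ?_, hxM⟩
        rintro _ rfl
        exact lie_self _
      · intro h
        refine hzx (h.le ⟨mem_relCentralizer_bot.mpr ?_, hzM⟩)
        rintro _ rfl
        rw [← lie_skew, hc, hc0, zero_smul, neg_zero]
    have := mem_relCentralizer_bot.mp (hN.ge hyM).1 x rfl
    exact hxy (by rw [← lie_skew, this, neg_zero])
  -- Without toral elements in `M`, `z` would be `p`-nilpotent, yet it has the nonzero eigenvalue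
  -- `-c` on `x`.
  · obtain ⟨t, htM, ht, ht0⟩ : ∃ t ∈ M, P.toFun t = t ∧ t ≠ 0 := by
      by_contra! hcon
      obtain ⟨s, hs, k, hk⟩ := P.exists_toral_add_nilpotent z
      have hs0 : s = 0 := by
        have : Submodule.span F {t | P.toFun t = t ∧ t ∈ P.closure {z}} = ⊥ := by
          rw [Submodule.span_eq_bot]
          exact fun t ht => hcon t (closure_le hMr (by simpa using hzM) ht.2) ht.1
        rwa [this, Submodule.mem_bot] at hs
      rw [hs0, sub_zero] at hk
      have := P.eq_zero_of_iterate_eq_zero (x := x) (c := -c) hx0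
        (by rw [← lie_skew, hc, neg_smul]) hk
      exact hc0 (neg_eq_zero.mp this)
    obtain ⟨i, hi⟩ := hL.exists_eigenvalue ht hx
    have hN : spanLie F {t, x} (lie_mem_span_pair hi) = M := by
      refine (hmax _ (P.isRestricted_spanLie _ ?_) ?_ ?_).resolve_left ?_
      · rintro u (rfl | rfl)
        · rw [ht]; exact Submodule.subset_span (by simp)
        · rw [hx]; exact Submodule.zero_mem _
      · exact line_le (Submodule.subset_span (by simp))
      · refine spanLie_le ?_
        rintro u (rfl | rfl)
        exacts [htM, hxM]
      · intro h
        have : t ∈ line F x := h.le (Submodule.subset_span (by simp))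
        obtain ⟨d, rfl⟩ := mem_line.mp this
        rw [P.toFun_smul, hx, smul_zero] at ht
        exact ht0 ht.symm
    rw [← hN, mem_spanLie, Submodule.mem_span_pair] at hyM
    obtain ⟨a, b, rfl⟩ := hyM
    by_cases hi0 : i = 0
    · refine hxy ?_
      rw [lie_add, lie_smul, lie_smul, lie_self, ← lie_skew, hi, hi0]
      simp
    · have ha := eq_zero_of_toFun_eq_zero hi0 hx0 hi hy
      refine hxy ?_
      rw [ha, zero_smul, zero_add, lie_smul, lie_self, smul_zero]

theorem IsUpperSemimodular.toFun_add_eq_zero (hL : P.IsUpperSemimodular) {x y : L}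
    (hx : P.toFun x = 0) (hy : P.toFun y = 0) : P.toFun (x + y) = 0 := by
  rw [P.toFun_add_of_lie_eq_zero (hL.lie_eq_zero hx hy), hx, hy, add_zero]

omit hp [CharP F p] [IsAlgClosed F] [FiniteDimensional F L] in
theorem toFun_smul_eq_zero {x : L} (hx : P.toFun x = 0) (c : F) : P.toFun (c • x) = 0 := by
  rw [P.toFun_smul, hx, smul_zero]

/-- The subspace of the elements with vanishing `p`-th power. -/
def IsUpperSemimodular.kernel (hL : P.IsUpperSemimodular) : Submodule F L where
  carrier := {a | P.toFun a = 0}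
  add_mem' := hL.toFun_add_eq_zero
  zero_mem' := P.toFun_zero
  smul_mem' := fun c _ hx => toFun_smul_eq_zero hx c

/-- A toral element acts by a scalar on the elements with vanishing `p`-th power. -/
theorem IsUpperSemimodular.exists_scalar (hL : P.IsUpperSemimodular) {t : L}
    (ht : P.toFun t = t) : ∃ c : F, ∀ a, P.toFun a = 0 → ⁅t, a⁆ = c • a := by
  by_cases h0 : ∀ a, P.toFun a = 0 → a = 0
  · exact ⟨0, fun a ha => by rw [h0 a ha, lie_zero, smul_zero]⟩
  push Not at h0
  obtain ⟨e, he, he0⟩ := h0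
  obtain ⟨c, hc⟩ := hL.exists_eigenvalue ht he
  refine ⟨c, fun a ha => ?_⟩
  obtain ⟨d, hd⟩ := hL.exists_eigenvalue ht ha
  -- The sum `e + a` is an eigenvector too, which forces the eigenvalues to agree.
  obtain ⟨m, hm⟩ := hL.exists_eigenvalue ht (hL.toFun_add_eq_zero he ha)
  rw [lie_add, hc, hd] at hm
  have h1 : (c - m) • e = (m - d) • a := by
    rw [← sub_eq_zero] at hm ⊢
    rw [← hm]
    module
  by_cases hcm : c = m
  · rw [hcm, sub_self, zero_smul] at h1
    rw [hd, hcm]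
    rcases smul_eq_zero.mp h1.symm with h | h
    · rw [sub_eq_zero.mp h]
    · rw [h, smul_zero, smul_zero]
  · have h2 := congrArg (fun v => ⁅t, v⁆) h1
    simp only [lie_smul, hc, hd] at h2
    rw [smul_comm, h1, smul_comm _ d a, ← sub_eq_zero, ← sub_smul, smul_smul] at h2
    rcases smul_eq_zero.mp h2 with h | h
    · rcases mul_eq_zero.mp h with h | h
      · rw [hd, sub_eq_zero.mp h]
      · rw [h, zero_smul] at h1
        exact absurd ((smul_eq_zero.mp h1).resolve_left (sub_ne_zero.mpr hcm)) he0
    · rw [h, lie_zero, smul_zero]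

/-- With `S = ⟨t, e⟩` and `T = ⟨y, e⟩`, `S` is maximal in the join `M`, which normalises `F e`. The
elements of `M` sending `t` into `F e` form a restricted subalgebra containing `S`, hence equal to
`S` or `M`; both cases are contradictory. -/
theorem IsUpperSemimodular.false_of_toFun_eq (hL : P.IsUpperSemimodular) {t y e : L}
    (ht : P.toFun t = t) (he : P.toFun e = 0) (he0 : e ≠ 0) (hte : ⁅t, e⁆ = e)
    (hy : P.toFun y = e) : False := by
  have hye : ⁅y, e⁆ = 0 := by
    rw [← hy, ← lie_skew, P.lie_toFun_eq_zero (lie_self y), neg_zero]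
  have hte1 : ⁅t, e⁆ = (1 : F) • e := by rw [hte, one_smul]
  have hye1 : ⁅y, e⁆ = (0 : F) • e := by rw [hye, zero_smul]
  set S := spanLie F {t, e} (lie_mem_span_pair hte1)
  set T := spanLie F {y, e} (lie_mem_span_pair hye1)
  have htS : t ∈ S := Submodule.subset_span (by simp)
  have heS : e ∈ S := Submodule.subset_span (by simp)
  have hyT : y ∈ T := Submodule.subset_span (by simp)
  have heT : e ∈ T := Submodule.subset_span (by simp)
  have hS : P.IsRestricted S := by
    refine P.isRestricted_spanLie _ ?_
    rintro u (rfl | rfl)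
    · rw [ht]; exact htS
    · rw [he]; exact Submodule.zero_mem _
  have hT : P.IsRestricted T := by
    refine P.isRestricted_spanLie _ ?_
    rintro u (rfl | rfl)
    · rw [hy]; exact heT
    · rw [he]; exact Submodule.zero_mem _
  have hyS : y ∉ S := by
    intro h
    rw [mem_spanLie, Submodule.mem_span_pair] at h
    obtain ⟨a, b, rfl⟩ := h
    rw [add_lie, smul_lie, smul_lie, lie_self, smul_zero, add_zero, hte, smul_eq_zero] at hye
    rw [hye.resolve_right he0, zero_smul, zero_add, P.toFun_smul, he, smul_zero] at hy
    exact he0 hy.symm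
  obtain ⟨-, hMr, hlt, hmax⟩ := hL.isMaximalIn hS hT hyT hyS fun z hz => by
    rw [mem_spanLie, Submodule.mem_span_pair] at hz
    obtain ⟨a, b, rfl⟩ := hz
    exact ⟨b • e, ⟨S.smul_mem b heS, T.smul_mem b heT⟩, a, add_comm _ _⟩
  set M := P.closure ((S : Set L) ∪ (T : Set L))
  have htM : t ∈ M := hlt.le htS
  have heM : e ∈ M := hlt.le heS
  have hyM : y ∈ M := P.subset_closure _ (Or.inr hyT)
  have hspan : ∀ {z : L} {c : F}, ⁅z, e⁆ = c • e → z ∈ relCentralizer (Submodule.span F {e}) ∅ := by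
    intro z c h
    refine ⟨fun s hs => ?_, by simp⟩
    obtain ⟨d, rfl⟩ := Submodule.mem_span_singleton.mp hs
    rw [lie_smul, h]
    exact Submodule.smul_mem _ _ (Submodule.smul_mem _ _ (Submodule.mem_span_singleton_self e))
  have heE : e ∈ relCentralizer (Submodule.span F {e}) ∅ :=
    hspan (c := 0) (by rw [lie_self, zero_smul])
  have hMN : M ≤ relCentralizer (Submodule.span F {e}) ∅ := by
    refine closure_le (P.isRestricted_relCentralizer _ _) (Set.union_subset ?_ ?_)
    · refine spanLie_le ?_
      rintro u (rfl | rfl)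
      exacts [hspan hte1, heE]
    · refine spanLie_le ?_
      rintro u (rfl | rfl)
      exacts [hspan hye1, heE]
  have hD : ∀ z ∈ M, z ∈ M ⊓ relCentralizer (Submodule.span F {e}) {t} ↔
      ⁅z, t⁆ ∈ Submodule.span F {e} := fun z hz =>
    ⟨fun h => h.2.2 t rfl, fun h => ⟨hz, (hMN hz).1, by rintro _ rfl; exact h⟩⟩
  rcases hmax _ (hMr.inf (P.isRestricted_relCentralizer (Submodule.span F {e}) {t}))
      (spanLie_le (by
        rintro u (rfl | rfl)
        · exact (hD _ htM).mpr (by rw [lie_self]; exact Submodule.zero_mem _)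
        · refine (hD _ heM).mpr ?_
          rw [← lie_skew, hte]
          exact Submodule.neg_mem _ (Submodule.mem_span_singleton_self _))) inf_le_left with h | h
  -- Here `f` turns out to lie in `K`, so `M` is spanned by `f, t, e`. As `y` commutes with `e`, it
  -- has no `t`-component, so it lies in `K`, against `y^[p] = e ≠ 0`.
  · obtain ⟨μ, f, hfM, hf, hfS⟩ := P.exists_eigenvector ht M htM S.toSubmodule hyM hyS
    have hμ : μ ≠ 0 := by
      rintro rfl
      refine hfS (h.le ((hD f hfM).mpr ?_))
      rw [← lie_skew, hf, zero_smul, neg_zero]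
      exact Submodule.zero_mem _
    have hf0 : f ≠ 0 := fun h0 => hfS (by rw [h0]; exact Submodule.zero_mem _)
    have h1 : ⁅P.toFun f, t⁆ = 0 := by
      exact P.lie_toFun_eq_zero_of_lie_lie (lie_lie_eq_zero_of_lie_eq_smul hf)
    have h2 : P.toFun f ∈ S := h.le ((hD _ (hMr f hfM)).mpr (by
      rw [h1]; exact Submodule.zero_mem _))
    have hPf : P.toFun f = 0 := by
      rw [mem_spanLie, Submodule.mem_span_pair] at h2
      obtain ⟨a, b, hab⟩ := h2
      have hb : b = 0 := by
        rw [← hab, add_lie, smul_lie, smul_lie, lie_self, smul_zero, zero_add, ← lie_skew, hte,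
          smul_neg, neg_eq_zero, smul_eq_zero] at h1
        exact h1.resolve_right he0
      have ha : a = 0 := by
        have h3 := P.lie_toFun_eq_zero (lie_self f)
        rw [← hab, hb, zero_smul, add_zero, smul_lie, hf, smul_eq_zero] at h3
        exact h3.resolve_right (smul_ne_zero hμ hf0)
      rw [← hab, ha, hb, zero_smul, zero_smul, add_zero]
    have hef : ⁅e, f⁆ = 0 := hL.lie_eq_zero he hPf
    have hbr : ∀ u ∈ ({f, t, e} : Set L), ∀ v ∈ ({f, t, e} : Set L),
        ⁅u, v⁆ ∈ Submodule.span F ({f, t, e} : Set L) := by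
      have hfs : f ∈ Submodule.span F ({f, t, e} : Set L) := Submodule.subset_span (by simp)
      have hes : e ∈ Submodule.span F ({f, t, e} : Set L) := Submodule.subset_span (by simp)
      have h0 : (0 : L) ∈ Submodule.span F ({f, t, e} : Set L) := Submodule.zero_mem _
      have hft : ⁅f, t⁆ ∈ Submodule.span F ({f, t, e} : Set L) := by
        rw [← lie_skew, hf]; exact Submodule.neg_mem _ (Submodule.smul_mem _ _ hfs)
      have hfe : ⁅f, e⁆ = 0 := by rw [← lie_skew, hef, neg_zero]
      have het : ⁅e, t⁆ ∈ Submodule.span F ({f, t, e} : Set L) := by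
        rw [← lie_skew, hte]; exact Submodule.neg_mem _ hes
      rintro u (rfl | rfl | rfl) v (rfl | rfl | rfl) <;> (try rw [lie_self]; exact h0)
      · exact hft
      · rw [hfe]; exact h0
      · rw [hf]; exact Submodule.smul_mem _ _ hfs
      · rw [hte]; exact hes
      · rw [hef]; exact h0
      · exact het
    have hN : spanLie F {f, t, e} hbr = M := by
      refine (hmax _ (P.isRestricted_spanLie _ ?_) ?_ ?_).resolve_left ?_
      · rintro u (rfl | rfl | rfl)
        · rw [hPf]; exact Submodule.zero_mem _
        · rw [ht]; exact Submodule.subset_span (by simp)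
        · rw [he]; exact Submodule.zero_mem _
      · refine spanLie_le ?_
        rintro u (rfl | rfl) <;> exact Submodule.subset_span (by simp)
      · refine spanLie_le ?_
        rintro u (rfl | rfl | rfl)
        exacts [hfM, htM, heM]
      · intro heq
        exact hfS (heq.le (Submodule.subset_span (by simp)))
    rw [← hN, mem_spanLie, Submodule.mem_span_triple] at hyM
    obtain ⟨c, a, b, rfl⟩ := hyM
    have ha : a = 0 := by
      rw [add_lie, add_lie, smul_lie, smul_lie, smul_lie, lie_self, hte, ← lie_skew f e, hef,
        neg_zero, smul_zero, smul_zero, zero_add, add_zero, smul_eq_zero] at hye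
      exact hye.resolve_right he0
    have h3 := hL.toFun_add_eq_zero (toFun_smul_eq_zero hPf c) (toFun_smul_eq_zero he b)
    rw [ha, zero_smul, add_zero, h3] at hy
    exact he0 hy.symm
  -- Now `[y, [y, t]] = 0`, so `e = y^[p]` would commute with `t`.
  · have h1 := (hD y hyM).mp (h.ge hyM)
    obtain ⟨c, hc⟩ := Submodule.mem_span_singleton.mp h1
    have h2 : ⁅y, ⁅y, t⁆⁆ = 0 := by rw [← hc, lie_smul, hye, smul_zero]
    have h3 := P.lie_toFun_eq_zero_of_lie_lie h2
    rw [hy, ← lie_skew, hte, neg_eq_zero] at h3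
    exact he0 h3

end UpperSemimodular

end PMapping

/-! ### The dichotomy: almost abelian, or central toral elements -/

namespace PMapping

section Classification

variable {p : ℕ} [hp : Fact p.Prime] {F L : Type*} [Field F] [LieRing L] [LieAlgebra F L]
  {P : PMapping p F L} [CharP F p] [IsAlgClosed F] [FiniteDimensional F L]

/-- The last nonzero `p`-power iterate lies in `K`, so by `false_of_toFun_eq` it cannot itself be a
`p`-th power. -/
theorem IsUpperSemimodular.toFun_eq_zero_of_iterate (hL : P.IsUpperSemimodular) {t : L}
    (ht : P.toFun t = t) (hta : ∀ a, P.toFun a = 0 → ⁅t, a⁆ = a) {y : L} :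
    ∀ {k : ℕ}, P.toFun^[k] y = 0 → P.toFun y = 0 := by
  intro k
  induction k with
  | zero =>
    intro h
    rw [Function.iterate_zero_apply] at h
    rw [h, P.toFun_zero]
  | succ k ih =>
    intro h
    rcases k with - | k
    · exact h
    refine ih ?_
    by_contra hne
    rw [Function.iterate_succ_apply'] at h
    exact hL.false_of_toFun_eq ht h hne (hta _ h) (Function.iterate_succ_apply' _ _ _).symm

/-- A toral element acting nontrivially on an element with vanishing `p`-th power forces the
algebra to be almost abelian. -/
theorem IsUpperSemimodular.isAlmostAbelian (hL : P.IsUpperSemimodular) {t e : L}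
    (ht : P.toFun t = t) (he : P.toFun e = 0) (hte : ⁅t, e⁆ ≠ 0) : IsAlmostAbelian F L := by
  have he0 : e ≠ 0 := fun h => hte (by rw [h, lie_zero])
  obtain ⟨t, ht, hta⟩ : ∃ t, P.toFun t = t ∧ ∀ a, P.toFun a = 0 → ⁅t, a⁆ = a := by
    obtain ⟨c, hc⟩ := hL.exists_scalar ht
    have hc0 : c ≠ 0 := fun h => hte (by rw [hc e he, h, zero_smul])
    have hcp := P.eigenvalue_pow ht he0 (hc e he)
    refine ⟨c⁻¹ • t, P.toFun_smul_of_pow_eq ht (by rw [inv_pow, hcp]), fun a ha => ?_⟩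
    rw [smul_lie, hc a ha, smul_smul, inv_mul_cancel₀ hc0, one_smul]
  have ht0 : t ≠ 0 := fun h => he0 (by rw [← hta e he, h, zero_lie])
  have htoral : ∀ u, P.toFun u = u → ∃ d : F, ∃ a ∈ hL.kernel, u = d • t + a := by
    intro u hu
    by_cases htu : ⁅t, u⁆ = 0
    · obtain ⟨j, hj⟩ := hL.exists_scalar hu
      have hjp := P.eigenvalue_pow hu he0 (hj e he)
      -- `v = u - j t` is toral, commutes with `t` and kills `e`; the aim is `v = 0`.
      have hv : P.toFun (u + (-j) • t) = u + (-j) • t := by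
        rw [P.toFun_add_of_lie_eq_zero (by rw [lie_smul, ← lie_skew, htu, neg_zero, smul_zero]),
          hu, P.toFun_smul_of_pow_eq ht (by
            have : ExpChar F p := ExpChar.prime hp.out
            rw [← frobenius_def, map_neg, frobenius_def, hjp])]
      set v := u + (-j) • t with hvdef
      have htv : ⁅t, v⁆ = 0 := by rw [hvdef, lie_add, lie_smul, lie_self, htu, smul_zero, add_zero]
      have hve : ⁅v, e⁆ = 0 := by
        rw [hvdef, add_lie, smul_lie, hj e he, hta e he]
        module
      -- Adding `e` gives a toral element not commuting with `t`, so it lies in some `F t + F f`.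
      -- This puts `v` in `K`, where a toral element is zero.
      have hw : P.toFun (t + v + e) = t + v + e := by
        rw [P.toFun_add_of_lie_eq_self (by rw [add_lie, hta e he, hve, add_zero]),
          P.toFun_add_of_lie_eq_zero htv, ht, hv, he, add_zero]
      obtain ⟨f, hf, -, a, b, hab⟩ := hL.exists_of_toral ht hw (by
        rw [lie_add, lie_add, lie_self, htv, hta e he, zero_add, zero_add]
        exact he0)
      have ha : a = 1 := by
        have h1 := congrArg (fun z => ⁅z, e⁆) hab
        simp only [add_lie, smul_lie, hta e he, hve, lie_self, hL.lie_eq_zero hf he, smul_zero,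
          add_zero] at h1
        rw [← sub_eq_zero]
        refine (smul_eq_zero.mp (?_ : (a - 1) • e = 0)).resolve_right he0
        rw [sub_smul, h1, one_smul, sub_self]
      have hvk : v = b • f + (-1 : F) • e := by
        rw [ha, one_smul, add_assoc, add_left_cancel_iff] at hab
        rw [hab]
        module
      have hv0 : v = 0 := by
        rw [← hv, hvk]
        exact hL.toFun_add_eq_zero (toFun_smul_eq_zero hf _) (toFun_smul_eq_zero he _)
      refine ⟨j, 0, Submodule.zero_mem _, ?_⟩
      rw [add_zero, ← sub_eq_zero, ← hv0, hvdef]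
      module
    · obtain ⟨f, hf, -, a, b, rfl⟩ := hL.exists_of_toral ht hu htu
      exact ⟨a, b • f, toFun_smul_eq_zero hf b, rfl⟩
  have hall : ∀ x : L, x ∈ Submodule.span F {t} ⊔ hL.kernel := by
    intro x
    obtain ⟨s, hs, k, hk⟩ := P.exists_toral_add_nilpotent x
    rw [← sub_add_cancel x s]
    refine Submodule.add_mem _ (Submodule.mem_sup_right (hL.toFun_eq_zero_of_iterate ht hta hk))
      (Submodule.span_le.mpr ?_ hs)
    rintro u ⟨hu, -⟩
    obtain ⟨d, a, ha, rfl⟩ := htoral u hu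
    exact Submodule.add_mem _ (Submodule.mem_sup_left
      (Submodule.smul_mem _ _ (Submodule.mem_span_singleton_self t))) (Submodule.mem_sup_right ha)
  let A : LieIdeal F L :=
    { hL.kernel with
      lie_mem := by
        intro x a ha
        obtain ⟨y, hy, b, hb, rfl⟩ := Submodule.mem_sup.mp (hall x)
        obtain ⟨c, rfl⟩ := Submodule.mem_span_singleton.mp hy
        have ha' : P.toFun a = 0 := ha
        have : ⁅c • t + b, a⁆ = c • a := by
          rw [add_lie, smul_lie, hta a ha, hL.lie_eq_zero hb ha, add_zero]
        change P.toFun ⁅c • t + b, a⁆ = 0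
        rw [this]
        exact toFun_smul_eq_zero ha' c }
  have hA : A.toSubmodule = hL.kernel := rfl
  refine ⟨t, A, ht0, ⟨fun x y => Subtype.ext (hL.lie_eq_zero x.2 y.2)⟩, ?_, hta⟩
  rw [hA]
  constructor
  · rw [Submodule.disjoint_def]
    intro x hx hxa
    obtain ⟨c, rfl⟩ := Submodule.mem_span_singleton.mp hx
    have := hta _ hxa
    rw [lie_smul, lie_self, smul_zero] at this
    exact this.symm
  · exact codisjoint_iff_le_sup.mpr fun x _ => hall x

/-- If the toral elements commute with each other then they are central. -/
theorem lie_eq_zero_of_toral_commute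
    (h : ∀ t u, P.toFun t = t → P.toFun u = u → ⁅t, u⁆ = 0) {t : L} (ht : P.toFun t = t) (x : L) :
    ⁅t, x⁆ = 0 := by
  by_contra htx
  obtain ⟨μ, f, -, hf, hfk⟩ := P.exists_eigenvector ht ⊤ (LieSubalgebra.mem_top t)
    (LieAlgebra.ad F L t).ker (LieSubalgebra.mem_top x) (by simpa using htx)
  rw [LinearMap.mem_ker, LieAlgebra.ad_apply, hf] at hfk
  have hμ : μ ≠ 0 := fun h => hfk (by rw [h, zero_smul])
  have hf0 : f ≠ 0 := fun h => hfk (by rw [h, smul_zero])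
  have hμp := P.eigenvalue_pow ht hf0 hf
  set u := μ⁻¹ • t with hu
  have hPu : P.toFun u = u := P.toFun_smul_of_pow_eq ht (by rw [inv_pow, hμp])
  have huf : ⁅u, f⁆ = f := by rw [hu, smul_lie, hf, smul_smul, inv_mul_cancel₀ hμ, one_smul]
  have hcomm : ⁅f, P.toFun f⁆ = 0 := by
    rw [← lie_skew, P.lie_toFun_eq_zero (lie_self f), neg_zero]
  have hcomm' : ⁅u, P.toFun f⁆ = 0 := by
    rw [← lie_skew, P.lie_toFun_eq_zero_of_lie_lie, neg_zero]
    exact lie_lie_eq_zero_of_lie_eq_smul (c := (1 : F)) (by rw [huf, one_smul])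
  -- Since `(u + f)^[p] = u + f + f^[p]`, every iterate retains the component `f`, which `u`
  -- detects. But some iterate lies in the span of the toral elements, which commute with `u`.
  have hk : ∀ k, ∃ g, ⁅u, g⁆ = 0 ∧ ⁅f, g⁆ = 0 ∧ P.toFun^[k] (u + f) = u + f + g := by
    intro k
    induction k with
    | zero => exact ⟨0, lie_zero _, lie_zero _, (add_zero _).symm⟩
    | succ k ih =>
      obtain ⟨g, hg1, hg2, hg⟩ := ih
      have hz : ∀ z : L, ⁅z, g⁆ = 0 → ⁅z, P.toFun g⁆ = 0 := fun z hz => by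
        rw [← lie_skew, P.lie_toFun_eq_zero, neg_zero]
        rw [← lie_skew, hz, neg_zero]
      refine ⟨P.toFun f + P.toFun g, ?_, ?_, ?_⟩
      · rw [lie_add, hcomm', hz u hg1, add_zero]
      · rw [lie_add, hcomm, hz f hg2, add_zero]
      · rw [Function.iterate_succ_apply', hg,
          P.toFun_add_of_lie_eq_zero (by rw [add_lie, hg1, hg2, add_zero]),
          P.toFun_add_of_lie_eq_self huf, hPu]
        abel
  obtain ⟨k, hmem⟩ := P.exists_iterate_mem_span_toral (u + f)
  obtain ⟨g, hg, -, hkg⟩ := hk k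
  have hle : Submodule.span F {t | P.toFun t = t} ≤ (LieAlgebra.ad F L u).ker :=
    Submodule.span_le.mpr fun v hv => by simpa using h u v hPu hv
  have := hle hmem
  rw [hkg, LinearMap.mem_ker, LieAlgebra.ad_apply, lie_add, lie_add, lie_self, huf, hg, add_zero,
    zero_add] at this
  exact hf0 this

omit hp [CharP F p] [IsAlgClosed F] in
variable (P) in
theorem exists_fin_closure_eq (s : Set L) :
    ∃ (r : ℕ) (x : Fin r → L), (∀ i, x i ∈ s) ∧ s ⊆ (P.closure (Set.range x) : Set L) := by
  obtain ⟨b, hbs, hb, hli⟩ := exists_linearIndependent F s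
  have hfin : Finite b := hli.finite
  obtain ⟨r, ⟨ε⟩⟩ := Finite.exists_equiv_fin b
  have hr : Set.range (fun i => (ε.symm i : L)) = b := by
    ext y
    constructor
    · rintro ⟨i, rfl⟩
      exact (ε.symm i).2
    · exact fun hy => ⟨ε ⟨y, hy⟩, by simp⟩
  refine ⟨r, fun i => (ε.symm i : L), fun i => hbs (ε.symm i).2, fun y hy => ?_⟩
  rw [hr]
  have : Submodule.span F b ≤ (P.closure b).toSubmodule := Submodule.span_le.mpr (P.subset_closure b)
  exact this (hb.ge (Submodule.subset_span hy))

omit hp [CharP F p] [IsAlgClosed F] [FiniteDimensional F L] in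
theorem exists_isPNilpotentOfOrder {x : L} (hx : P.toFun x ≠ 0) {k : ℕ}
    (hk : P.toFun^[k] x = 0) (h0 : P.toFun 0 = 0) :
    ∃ n, P.IsPNilpotentOfOrder x n ∧ 1 < n := by
  classical
  have hex : ∃ m, 0 < m ∧ P.toFun^[m] x = 0 :=
    ⟨k + 1, Nat.succ_pos k, by rw [Function.iterate_succ_apply', hk, h0]⟩
  refine ⟨Nat.find hex, ⟨Nat.find_spec hex, fun m hm => Nat.find_min' hex hm⟩, ?_⟩
  obtain ⟨h1, h2⟩ := Nat.find_spec hex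
  refine lt_of_le_of_ne h1 fun h => hx ?_
  rwa [← h] at h2

/-- If the toral elements are central, then `L` is generated by the `p`-nilpotent elements of
order greater than one together with an abelian restricted subalgebra. -/
theorem IsUpperSemimodular.exists_generators (hL : P.IsUpperSemimodular)
    (hc : ∀ t, P.toFun t = t → ∀ x : L, ⁅t, x⁆ = 0) :
    ∃ (r : ℕ) (x : Fin r → L) (n : Fin r → ℕ) (B : LieSubalgebra F L),
      (∀ i, P.IsPNilpotentOfOrder (x i) (n i) ∧ 1 < n i) ∧
      P.IsRestricted B ∧ IsLieAbelian B ∧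
      P.closure (Set.range x ∪ (B : Set L)) = ⊤ ∧
      ((⁅(⊤ : LieIdeal F L), (⊤ : LieIdeal F L)⁆ : LieIdeal F L) : Set L) ⊆
        (P.closure (Set.range x) : Set L) := by
  let N : Set L := {y | P.toFun y ≠ 0 ∧ ∃ k, P.toFun^[k] y = 0}
  obtain ⟨r, x, hxN, hNx⟩ := P.exists_fin_closure_eq N
  choose n hn using fun i =>
    let ⟨_, hk⟩ := (hxN i).2
    exists_isPNilpotentOfOrder (hxN i).1 hk P.toFun_zero
  let G : Set L := {t | P.toFun t = t} ∪ {a | P.toFun a = 0}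
  have hG : ∀ u ∈ G, ∀ v ∈ G, ⁅u, v⁆ = 0 := by
    rintro u (hu | hu) v (hv | hv)
    · exact hc u hu v
    · exact hc u hu v
    · rw [← lie_skew, hc v hv, neg_zero]
    · exact hL.lie_eq_zero hu hv
  have hdec : ∀ z : L, ∃ s ∈ Submodule.span F {t | P.toFun t = t}, ∃ m,
      z = s + m ∧ (P.toFun m = 0 ∨ m ∈ N) := by
    intro z
    obtain ⟨s, hs, k, hk⟩ := P.exists_toral_add_nilpotent z
    refine ⟨s, Submodule.span_mono (fun t ht => ht.1) hs, z - s, by abel, ?_⟩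
    by_cases h : P.toFun (z - s) = 0
    · exact Or.inl h
    · exact Or.inr ⟨h, k, hk⟩
  have hcs : ∀ s ∈ Submodule.span F {t | P.toFun t = t}, ∀ z : L, ⁅s, z⁆ = 0 := by
    intro s hs z
    induction hs using Submodule.span_induction with
    | mem t ht => exact hc t ht z
    | zero => exact zero_lie z
    | add u v _ _ hu hv => rw [add_lie, hu, hv, add_zero]
    | smul c u _ hu => rw [smul_lie, hu, smul_zero]
  have hNN : ∀ u ∈ N, ∀ v ∈ N, ⁅u, v⁆ ∈ P.closure (Set.range x) := fun u hu v hv =>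
    LieSubalgebra.lie_mem _ (hNx hu) (hNx hv)
  have hNA : ∀ u ∈ N, ∀ a, P.toFun a = 0 → ⁅u, a⁆ ∈ P.closure (Set.range x) := by
    intro u hu a ha
    -- The bracket is rewritten as `[u, u + a] = [u, m]`. If `m` is in `N`, this is a bracket within
    -- `N`; if `m` is in `K`, then `u = s + m - a` commutes with `a`.
    obtain ⟨s, hs, m, hm, hm'⟩ := hdec (u + a)
    rcases hm' with hm' | hm'
    · have : u = s + m - a := by rw [← hm]; abel
      rw [this, sub_lie, add_lie, hcs s hs, hL.lie_eq_zero hm' ha, lie_self]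
      simp
    · have : ⁅u, a⁆ = ⁅u, m⁆ := by
        rw [← add_zero ⁅u, a⁆, ← zero_add ⁅u, m⁆, ← lie_self u, add_comm, ← lie_add, hm, lie_add,
          ← lie_skew u s, hcs s hs, neg_zero, lie_self]
      rw [this]
      exact hNN u hu m hm'
  refine ⟨r, x, n, P.closure G, hn, P.isRestricted_closure G,
    ⟨fun u v => Subtype.ext (P.lie_eq_zero_of_mem_closure hG u u.2 v v.2)⟩, ?_, ?_⟩
  · rw [eq_top_iff]
    intro z _
    set K := P.closure (Set.range x ∪ (P.closure G : Set L))
    have hBK : ∀ g ∈ G, g ∈ K := fun g hg => P.subset_closure _ (Or.inr (P.subset_closure _ hg))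
    have hxK : P.closure (Set.range x) ≤ K :=
      closure_le (P.isRestricted_closure _) fun y hy => P.subset_closure _ (Or.inl hy)
    obtain ⟨s, hs, m, rfl, hm⟩ := hdec z
    refine K.add_mem ?_ ?_
    · exact (Submodule.span_le (p := K.toSubmodule)).mpr (fun t ht => hBK t (Or.inl ht)) hs
    · exact hm.elim (fun h => hBK m (Or.inr h)) fun h => hxK (hNx h)
  · have hbr : ∀ y z : L, ⁅y, z⁆ ∈ P.closure (Set.range x) := by
      intro y z
      obtain ⟨s, hs, m, rfl, hm⟩ := hdec y
      obtain ⟨s', hs', m', rfl, hm'⟩ := hdec z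
      have : ⁅s + m, s' + m'⁆ = ⁅m, m'⁆ := by
        rw [add_lie, hcs s hs, zero_add, lie_add, ← lie_skew m s', hcs s' hs', neg_zero, zero_add]
      rw [this]
      rcases hm with hm | hm <;> rcases hm' with hm' | hm'
      · rw [hL.lie_eq_zero hm hm']; exact LieSubalgebra.zero_mem _
      · rw [← lie_skew]; exact neg_mem (hNA m' hm' m hm)
      · exact hNA m hm m' hm'
      · exact hNN m hm m' hm'
    intro w hw
    have hw' : w ∈ (⁅(⊤ : LieIdeal F L), (⊤ : LieIdeal F L)⁆ : LieIdeal F L).toSubmodule := hw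
    rw [LieSubmodule.lieIdeal_oper_eq_linear_span'] at hw'
    refine (Submodule.span_le (p := (P.closure (Set.range x)).toSubmodule)).mpr ?_ hw'
    rintro _ ⟨y, -, z, -, rfl⟩
    exact hbr y z

end Classification

end PMapping

theorem mainTheorem3 (p : ℕ) [Fact p.Prime] (F : Type*) [Field F] [IsAlgClosed F] [CharP F p]
    (L : Type*) [LieRing L] [LieAlgebra F L] [FiniteDimensional F L]
    (P : PMapping p F L) (hL : P.IsUpperSemimodular) :
    IsLieAbelian L ∨ IsAlmostAbelian F L ∨
      ∃ (r : ℕ) (x : Fin r → L) (n : Fin r → ℕ) (B : LieSubalgebra F L),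
        (∀ i, P.IsPNilpotentOfOrder (x i) (n i) ∧ 1 < n i) ∧
        P.IsRestricted B ∧ IsLieAbelian B ∧
        P.closure (Set.range x ∪ (B : Set L)) = ⊤ ∧
        ((⁅(⊤ : LieIdeal F L), (⊤ : LieIdeal F L)⁆ : LieIdeal F L) : Set L) ⊆
          (P.closure (Set.range x) : Set L) := by
  by_cases h : ∃ t e, P.toFun t = t ∧ P.toFun e = 0 ∧ ⁅t, e⁆ ≠ 0
  · obtain ⟨t, e, ht, he, hte⟩ := h
    exact Or.inr (Or.inl (hL.isAlmostAbelian ht he hte))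
  · push Not at h
    refine Or.inr (Or.inr (hL.exists_generators fun t ht x =>
      PMapping.lie_eq_zero_of_toral_commute (fun t u ht hu => ?_) ht x))
    by_contra htu
    obtain ⟨f, hf, htf, -⟩ := hL.exists_of_toral ht hu htu
    exact htf (h t f ht hf)
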